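/- Let $p>2$ be a prime, $m>1$ an integer, $\omega$ a primitive element of $\mathbb F_{p^m}$ (a generator of $\mathbb F_{p^m}^\times$), and $\mathrm{Tr}:\mathbb F_{p^m}\to\mathbb F_p$ the trace map. Put $N=2(p^m-1)/(p-1)$. Define sequences $T^{(1)}=(t^{(1)}_n)_{n\ge 0}$ and $T^{(2)}=(t^{(2)}_n)_{n\ge 0}$ over $\mathbb F_2$ through the Legendre symbol $\lambda_n=\left(\frac{\mathrm{Tr}(\omega^n)}{p}\right)$: if $\lambda_n=1$, then $t^{(1)}_n=t^{(2)}_n=0$; if $\lambda_n=-1$, then $t^{(1)}_n=t^{(2)}_n=1$; if $\lambda_n=0$, then $t^{(1)}_n=0$ and $t^{(2)}_n=1$. For $e\in\{0,1,\dots,N-1\}$ let $S^e=(s^e_n)_{n\ge 0}$ be the interleaved sequence of $T^{(1)}$ and the left shift $L^e(T^{(2)})$, that is, $s^e_{2j}=t^{(1)}_j$ and $s^e_{2j+1}=t^{(2)}_{j+e}$ for $j\ge 0$. For a sequence $S=(s_n)_{n\ge0}$ over $\mathbb F_2$, the linear complexity $L(S)$ is the length $L$ of the shortest linear recurrence relation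 $s_{n+L}=a_{L-1}s_{n+L-1}+\cdots+a_0s_n$ $(n\ge 0)$ with $a_i\in\mathbb F_2$ satisfied by $S$, and the minimal polynomial of $S$ is the corresponding polynomial $x^L-a_{L-1}x^{L-1}-\cdots-a_0\in\mathbb F_2[x]$. Let $\nu_2(N)$ be the exponent of the largest power of $2$ dividing $N$, let $N'=N/2^{\nu_2(N)}$, and let $G(N,e)=\gcd(N',u)$, where $u\in\{1,\dots,N'\}$ is the integer with $u\equiv -2e+1 \pmod{N'}$. Then $x^{G(N,e)}-1$ divides $x^{2N}-1$ in $\mathbb F_2[x]$, the minimal polynomial of $S^e$ exists, is unique, and equals $$m(x)=\frac{x^{2N}-1}{x^{G(N,e)}-1},$$ and the linear complexity of $S^e$ is $L(S^e)=2N-G(N,e)$. -/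

import Mathlib

open Polynomial

/-! ### Linear complexity and minimal polynomials of sequences over a field -/

/-- The linear complexity of a sequence `s`: the length (order) of the shortest linear recurrence
relation `s (n + L) = a (L - 1) * s (n + L - 1) + ⋯ + a 0 * s n`, `n ≥ 0`, that `s` satisfies.
(Junk value `0` if `s` satisfies no linear recurrence.) -/
noncomputable def linearComplexity {F : Type*} [Field F] (s : ℕ → F) : ℕ :=
  sInf {L : ℕ | ∃ E : LinearRecurrence F, E.order = L ∧ E.IsSolution s}

/-- `f` is a minimal polynomial of the sequence `s`: it is the characteristic polynomial
`X ^ L - a (L - 1) * X ^ (L - 1) - ⋯ - a 0` of a shortest linear recurrence relation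
satisfied by `s`. -/
def IsMinimalPolynomial {F : Type*} [Field F] (s : ℕ → F) (f : F[X]) : Prop :=
  ∃ E : LinearRecurrence F, E.IsSolution s ∧
    (∀ E' : LinearRecurrence F, E'.IsSolution s → E.order ≤ E'.order) ∧ E.charPoly = f

/-! ### Interleaving and left shifts -/

/-- The interleaved sequence `u` of a family of `T` sequences: `u (j * T + i) = S i j` for
`0 ≤ i < T` and `0 ≤ j`. -/
def interleave {α : Type*} {T : ℕ} [NeZero T] (S : Fin T → ℕ → α) (n : ℕ) : α :=
  S (Fin.ofNat T n) (n / T)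

theorem interleave_apply {α : Type*} {T : ℕ} [NeZero T] (S : Fin T → ℕ → α) (i : Fin T) (j : ℕ) :
    interleave S (j * T + i) = S i j := by
  have hT : 0 < T := Nat.pos_of_ne_zero (NeZero.ne T)
  have h1 : Fin.ofNat T (j * T + i) = i := by
    ext
    simp [Fin.ofNat, Nat.mod_eq_of_lt i.isLt]
  have h2 : (j * T + (i : ℕ)) / T = j := by
    rw [mul_comm, Nat.mul_add_div hT, Nat.div_eq_of_lt i.isLt, add_zero]
  simp only [interleave, h1, h2]

/-- The left shift `L ^ e` of a sequence. -/
def leftShift {α : Type*} (e : ℕ) (s : ℕ → α) (n : ℕ) : α := s (n + e)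

/-! ### Geometric sequences binarized with the Legendre symbol -/

/-- The Legendre symbol `(Tr (ω ^ n) / p)`, with `Tr` the trace from `K` to `ZMod p`. -/
noncomputable def traceLegendre (p : ℕ) [Fact p.Prime] {K : Type*} [Field K] [Algebra (ZMod p) K]
    (ω : Kˣ) (n : ℕ) : ℤ :=
  legendreSym p ((Algebra.trace (ZMod p) K ((ω : K) ^ n)).val : ℤ)

/-- The geometric sequence `T^(1)` of the first type. -/
noncomputable def geomSeq₁ (p : ℕ) [Fact p.Prime] {K : Type*} [Field K] [Algebra (ZMod p) K]
    (ω : Kˣ) (n : ℕ) : ZMod 2 :=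
  if traceLegendre p ω n = 1 then 0 else if traceLegendre p ω n = -1 then 1 else 0

/-- The geometric sequence `T^(2)` of the second type. -/
noncomputable def geomSeq₂ (p : ℕ) [Fact p.Prime] {K : Type*} [Field K] [Algebra (ZMod p) K]
    (ω : Kˣ) (n : ℕ) : ZMod 2 :=
  if traceLegendre p ω n = 1 then 0 else if traceLegendre p ω n = -1 then 1 else 1

/-- The interleaved sequence `S^e` of `T^(1)` and `L^e (T^(2))`. -/
noncomputable def interleavedGeomSeq (p : ℕ) [Fact p.Prime] {K : Type*} [Field K]
    [Algebra (ZMod p) K] (ω : Kˣ) (e : ℕ) : ℕ → ZMod 2 :=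
  interleave ![geomSeq₁ p ω, leftShift e (geomSeq₂ p ω)]

/-! ### The numbers `N` and `G(N, e)` -/

/-- `N = 2 (p ^ m - 1) / (p - 1)`; the division is exact. -/
def geomPeriod (p m : ℕ) : ℕ := 2 * (p ^ m - 1) / (p - 1)

/-- The integer `u ∈ {1, …, n}` with `u ≡ a mod n`, for `n ≥ 1`. -/
def posMod (a : ℤ) (n : ℕ) : ℕ := if a % (n : ℤ) = 0 then n else (a % (n : ℤ)).toNat

theorem posMod_mem (a : ℤ) {n : ℕ} (hn : 0 < n) : posMod a n ∈ Set.Icc 1 n := by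
  have h0 := Int.emod_nonneg a (by omega : (n : ℤ) ≠ 0)
  have h1 := Int.emod_lt_of_pos a (by omega : (0 : ℤ) < n)
  unfold posMod
  split_ifs with h
  · exact ⟨hn, le_rfl⟩
  · constructor <;> omega

theorem posMod_modEq (a : ℤ) {n : ℕ} (hn : 0 < n) : (posMod a n : ℤ) ≡ a [ZMOD n] := by
  have h0 := Int.emod_nonneg a (by omega : (n : ℤ) ≠ 0)
  unfold posMod
  split_ifs with h
  · simp [Int.ModEq, h]
  · rw [Int.toNat_of_nonneg h0]
    exact Int.mod_modEq a n

/-- `G(N, e) = gcd (N / 2 ^ ν₂(N), (-2 e + 1) mod N / 2 ^ ν₂(N))`. -/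
def gcdParam (N e : ℕ) : ℕ :=
  Nat.gcd (N / 2 ^ padicValNat 2 N) (posMod (-2 * (e : ℤ) + 1) (N / 2 ^ padicValNat 2 N))

/-!
Put `M = (p ^ m - 1) / (p - 1)`, so `N = 2 * M`. Since `ω ^ M` is a nonsquare of the prime field
(`exists_nonsquare_eq_pow`), passing from `n` to `n + M` negates the Legendre symbol of
`Tr (ω ^ n)`. Hence both geometric sequences satisfy `t n + t (n + M) = w n` over `ZMod 2`, where
`w` is the `M`-periodic indicator of `Tr (ω ^ n) ≠ 0`.

The indicator `w` is that of the complement of a Singer difference set. All that is needed of it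
is parity: counting over `K` with the linear maps `Tr x` and `(Tr x, Tr (a * x))` shows that the
autocorrelation of `w` is odd at shift `0` and even at all other shifts. Therefore
`W(y) * W(y⁻¹) = 1` at every `M`-th root of unity `y` in characteristic two, with
`W(y) = ∑ w_j y ^ j` (`sum_pow_mul_sum_pow_eq_one`), and `W` vanishes at none of them.

A polynomial annihilates a `P`-periodic sequence under the shift if and only if `X ^ P - 1` divides
its product with the period polynomial `R` of the sequence, so the minimal polynomial is
`(X ^ P - 1) / gcd (X ^ P - 1, R)` (`annihilator_of_periodic`). For the interleaved sequence,
`P = 2 * N`. At a root `β = γ⁻¹` of `X ^ P - 1`, which is also an `M`-th root of unity, folding the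
sum over one period gives `R(β) = v * (γ ^ (2 * e) + γ)` with `v = γ ^ (-2 * e) * W(γ ^ 2)` a unit,
and `β * R'(β) = γ * v` (`IsComplementPair.exists_isUnit_aeval`). So the common roots of `R` and
`X ^ P - 1` are those with `γ ^ (2 * e - 1) = 1`, that is, the roots of `X ^ G - 1` with
`G = gcdParam N e`, and each is a simple root of `R`: the greatest common divisor is `X ^ G - 1`.
-/

/-! ### Annihilators of sequences -/

/-- The shift operator `(s n) ↦ (s (n + 1))` on sequences. A polynomial `f` acts on sequences
as `aeval (seqShift F) f`, and `s` satisfies the linear recurrence with characteristic polynomial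
`f` exactly when this kills `s`. -/
def seqShift (F : Type*) [CommSemiring F] : (ℕ → F) →ₗ[F] (ℕ → F) :=
  LinearMap.funLeft F F Nat.succ

theorem seqShift_pow_apply {F : Type*} [CommSemiring F] (i : ℕ) (s : ℕ → F) (n : ℕ) :
    (seqShift F ^ i) s n = s (n + i) := by
  induction i generalizing n with
  | zero => simp
  | succ k ih =>
    rw [pow_succ', Module.End.mul_apply, seqShift, LinearMap.funLeft_apply]
    exact (ih _).trans (congrArg s (by omega))

theorem aeval_seqShift_monomial {F : Type*} [CommSemiring F] (i : ℕ) (a : F) (s : ℕ → F) (n : ℕ) :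
    aeval (seqShift F) (monomial i a) s n = a * s (n + i) := by
  rw [aeval_monomial, Module.End.mul_apply, Module.algebraMap_end_apply, Pi.smul_apply,
    seqShift_pow_apply, smul_eq_mul]

theorem aeval_seqShift_apply {F : Type*} [CommSemiring F] {k : ℕ} {f : F[X]} (hf : f.natDegree < k)
    (s : ℕ → F) (n : ℕ) :
    aeval (seqShift F) f s n = ∑ i ∈ Finset.range k, f.coeff i * s (n + i) := by
  conv_lhs => rw [f.as_sum_range' k hf]
  simp only [map_sum, LinearMap.sum_apply, Finset.sum_apply, aeval_seqShift_monomial]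

theorem LinearRecurrence.isSolution_iff_aeval_seqShift {F : Type*} [CommRing F]
    (E : LinearRecurrence F) (s : ℕ → F) :
    E.IsSolution s ↔ aeval (seqShift F) E.charPoly s = 0 := by
  simp only [IsSolution, funext_iff, charPoly, map_sub, map_sum, LinearMap.sub_apply,
    LinearMap.sum_apply, Finset.sum_apply, aeval_seqShift_monomial, one_mul, sub_eq_zero]

theorem LinearRecurrence.charPoly_natDegree {F : Type*} [CommRing F] [Nontrivial F]
    (E : LinearRecurrence F) : E.charPoly.natDegree = E.order :=
  natDegree_eq_of_degree_eq_some E.charPoly_degree_eq_order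

theorem Polynomial.Monic.exists_linearRecurrence {F : Type*} [CommRing F] {f : F[X]}
    (hf : f.Monic) : ∃ E : LinearRecurrence F, E.charPoly = f := by
  refine ⟨⟨f.natDegree, fun i => -f.coeff i⟩, ?_⟩
  conv_rhs => rw [hf.as_sum]
  simp only [LinearRecurrence.charPoly, ← C_mul_X_pow_eq_monomial, C_neg, neg_mul,
    Finset.sum_neg_distrib, sub_neg_eq_add, C_1, one_mul]
  rw [Fin.sum_univ_eq_sum_range (fun i => C (f.coeff i) * X ^ i)]

section Annihilator

variable {F : Type*} [Field F] {s : ℕ → F} {g : F[X]}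

/-- A monic generator of the annihilator of `s` under the shift is the unique minimal polynomial
of `s`. -/
theorem isMinimalPolynomial_iff_of_annihilator (hg : g.Monic)
    (h : ∀ f, aeval (seqShift F) f s = 0 ↔ g ∣ f) (f : F[X]) :
    IsMinimalPolynomial s f ↔ f = g := by
  obtain ⟨E₀, hE₀⟩ := hg.exists_linearRecurrence
  have hsol : ∀ E : LinearRecurrence F, E.IsSolution s ↔ g ∣ E.charPoly := fun E => by
    rw [E.isSolution_iff_aeval_seqShift, h]
  have hle : ∀ E : LinearRecurrence F, E.IsSolution s → E₀.order ≤ E.order := fun E hE => by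
    rw [← E.charPoly_natDegree, ← E₀.charPoly_natDegree, hE₀]
    exact natDegree_le_of_dvd ((hsol E).1 hE) E.charPoly_monic.ne_zero
  have hE₀s : E₀.IsSolution s := (hsol E₀).2 hE₀.symm.dvd
  constructor
  · rintro ⟨E, hE, hmin, rfl⟩
    refine eq_of_monic_of_dvd_of_natDegree_le hg E.charPoly_monic ((hsol E).1 hE) ?_
    rw [E.charPoly_natDegree, ← hE₀, E₀.charPoly_natDegree]
    exact hmin E₀ hE₀s
  · rintro rfl
    exact ⟨E₀, hE₀s, hle, hE₀⟩

theorem linearComplexity_of_annihilator (hg : g.Monic)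
    (h : ∀ f, aeval (seqShift F) f s = 0 ↔ g ∣ f) : linearComplexity s = g.natDegree := by
  obtain ⟨E, hE, hmin, hEg⟩ := (isMinimalPolynomial_iff_of_annihilator hg h g).2 rfl
  rw [← hEg, E.charPoly_natDegree]
  refine le_antisymm (Nat.sInf_le ⟨E, rfl, hE⟩) (le_csInf ⟨_, E, rfl, hE⟩ ?_)
  rintro _ ⟨E', rfl, hE'⟩
  exact hmin E' hE'

/-- The polynomial `∑ s_j X ^ (P - j)` over one period of a `P`-periodic sequence; it is the
generating polynomial of the reversed sequence, up to a power of `X` modulo `X ^ P - 1`. -/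
noncomputable def periodPoly (s : ℕ → F) (P : ℕ) : F[X] :=
  ∑ j ∈ Finset.range P, monomial (P - j) (s j)

/-- The indicator sequence of the multiples of `P`. It generates the `P`-periodic sequences as
a module over `F[X]`, with annihilator `X ^ P - 1`. -/
def impulse (F : Type*) [Field F] (P : ℕ) (n : ℕ) : F := if P ∣ n then 1 else 0

theorem aeval_periodPoly_impulse {P : ℕ} (hP : 0 < P) (hs : Function.Periodic s P) :
    aeval (seqShift F) (periodPoly s P) (impulse F P) = s := by
  ext n
  simp only [periodPoly, map_sum, LinearMap.sum_apply, Finset.sum_apply, aeval_seqShift_monomial,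
    impulse]
  rw [Finset.sum_eq_single (n % P)]
  · have h1 : P ∣ n + (P - n % P) := by
      have := Nat.mod_lt n hP
      have h2 := Nat.mod_add_div n P
      refine ⟨n / P + 1, ?_⟩
      rw [mul_add]
      omega
    rw [if_pos h1, mul_one, hs.map_mod_nat]
  · intro j hj hne
    have hj := Finset.mem_range.1 hj
    rw [if_neg, mul_zero]
    intro hd
    apply hne
    have h3 : (n + (P - j) + j) % P = (0 + j) % P :=
      Nat.ModEq.add_right j (Nat.modEq_zero_iff_dvd.2 hd)
    rw [show n + (P - j) + j = n + P by omega, Nat.add_mod_right, zero_add,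
      Nat.mod_eq_of_lt hj] at h3
    exact h3.symm
  · intro h
    exact absurd (Finset.mem_range.2 (Nat.mod_lt n hP)) h

theorem aeval_impulse_eq_zero_iff {P : ℕ} (hP : 0 < P) (f : F[X]) :
    aeval (seqShift F) f (impulse F P) = 0 ↔ X ^ P - 1 ∣ f := by
  have hmon : (X ^ P - 1 : F[X]).Monic := by
    simpa using monic_X_pow_sub_C (1 : F) hP.ne'
  have hker : aeval (seqShift F) (X ^ P - 1 : F[X]) (impulse F P) = 0 := by
    ext n
    simp [seqShift_pow_apply, impulse]
  have hdvd : ∀ f : F[X], X ^ P - 1 ∣ f → aeval (seqShift F) f (impulse F P) = 0 := by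
    rintro _ ⟨q, rfl⟩
    rw [mul_comm, map_mul, Module.End.mul_apply, hker, map_zero]
  refine ⟨fun hf => ?_, hdvd f⟩
  rw [← modByMonic_eq_zero_iff_dvd hmon]
  set r := f %ₘ (X ^ P - 1) with hr
  have hrf : aeval (seqShift F) r (impulse F P) = 0 := by
    have h1 : r = f - (X ^ P - 1) * (f /ₘ (X ^ P - 1)) :=
      eq_sub_of_add_eq (modByMonic_add_div f _)
    rw [h1, map_sub, LinearMap.sub_apply, hf, hdvd _ (dvd_mul_right _ _), sub_zero]
  have hdeg : r.natDegree < P := by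
    have h1 : (X ^ P - 1 : F[X]).natDegree = P := by
      simpa using natDegree_X_pow_sub_C (n := P) (r := (1 : F))
    have := natDegree_modByMonic_lt f hmon (fun h => by rw [h] at h1; simp at h1; omega)
    rwa [h1] at this
  ext i
  rw [coeff_zero]
  rcases le_or_gt P i with hi | hi
  · exact coeff_eq_zero_of_natDegree_lt (hdeg.trans_le hi)
  -- the value of the shifted impulse at `P - i` isolates the `i`-th coefficient
  have h1 := congrFun hrf (P - i)
  rw [aeval_seqShift_apply hdeg, Finset.sum_eq_single i] at h1
  · simpa [impulse, Nat.sub_add_cancel hi.le] using h1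
  · intro j hj hne
    have hj := Finset.mem_range.1 hj
    rw [impulse, if_neg, mul_zero]
    rintro ⟨c, hc⟩
    rcases c with _ | _ | c
    · omega
    · omega
    · rw [mul_add, mul_add] at hc
      have := Nat.zero_le (P * c)
      omega
  · exact fun h => absurd (Finset.mem_range.2 hi) h

/-- If `gcd (X ^ P - 1, R) = d` for the period polynomial `R` of a `P`-periodic sequence, with
`X ^ P - 1 = d * g`, then `g` generates the annihilator of the sequence. -/
theorem annihilator_of_periodic {P : ℕ} (hP : 0 < P) (hs : Function.Periodic s P)
    {d r : F[X]} (hR : periodPoly s P = d * r) (hg : X ^ P - 1 = d * g) (hco : IsCoprime g r)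
    (f : F[X]) : aeval (seqShift F) f s = 0 ↔ g ∣ f := by
  have hd : d ≠ 0 := by
    rintro rfl
    exact X_pow_sub_C_ne_zero hP (1 : F) (by simpa using hg)
  conv_lhs => rw [← aeval_periodPoly_impulse hP hs]
  rw [← Module.End.mul_apply, ← map_mul, aeval_impulse_eq_zero_iff hP, hR, hg, mul_left_comm,
    mul_dvd_mul_iff_left hd]
  exact ⟨fun h => hco.dvd_of_dvd_mul_right h, fun h => h.mul_right r⟩

end Annihilator

/-! ### Periodic sums -/

theorem Function.Periodic.sum_range_add {A : Type*} [AddCommGroup A] {f : ℕ → A} {M : ℕ}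
    (hf : Function.Periodic f M) (d : ℕ) :
    ∑ i ∈ Finset.range M, f (i + d) = ∑ i ∈ Finset.range M, f i := by
  induction d with
  | zero => rfl
  | succ d ih =>
    rw [← ih]
    have h := (Finset.sum_range_succ (fun i => f (i + d)) M).symm.trans
      (Finset.sum_range_succ' (fun i => f (i + d)) M)
    have h1 : f (M + d) = f (0 + d) := by rw [add_comm M, hf, zero_add]
    simp only [h1, add_left_inj] at h
    rw [h]
    exact Finset.sum_congr rfl fun i _ => congrArg f (by omega)

theorem Function.Periodic.card_filter_range_mul {Q : ℕ → Prop} [DecidablePred Q] {M : ℕ}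
    (hQ : Function.Periodic Q M) (k : ℕ) :
    ((Finset.range (k * M)).filter Q).card = k * ((Finset.range M).filter Q).card := by
  simp only [← Nat.count_eq_card_filter_range]
  induction k with
  | zero => simp
  | succ k ih =>
    have h : ∀ n, Q (k * M + n) ↔ Q n := fun n => by
      rw [add_comm, iff_eq_eq]
      exact hQ.nat_mul k n
    rw [add_mul, one_mul, Nat.count_add, ih, add_mul, one_mul]
    simp only [h]

/-- Evaluated at `y` and at its inverse `z`, the period polynomial of a `0`-`1` sequence whose
autocorrelation is odd at shift `0` and even at all other shifts takes inverse values in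
characteristic two. -/
theorem sum_pow_mul_sum_pow_eq_one {A : Type*} [CommRing A] [CharP A 2] {Q : ℕ → Prop}
    [DecidablePred Q] {M : ℕ} (hM : 0 < M) (hQ : Function.Periodic Q M)
    (h0 : Odd ((Finset.range M).filter Q).card)
    (hd : ∀ d, 0 < d → d < M → Even ((Finset.range M).filter fun j => Q j ∧ Q (j + d)).card)
    {y z : A} (hyz : y * z = 1) (hy : y ^ M = 1) :
    (∑ i ∈ Finset.range M, if Q i then y ^ i else 0) *
      (∑ j ∈ Finset.range M, if Q j then z ^ j else 0) = 1 := by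
  have hper : Function.Periodic (fun i => if Q i then y ^ i else 0) M := fun i => by
    simp only [hQ i, pow_add, hy, mul_one]
  have hcast : ∀ {n : ℕ}, Even n → (n : A) = 0 := fun {n} hn =>
    (CharP.cast_eq_zero_iff A 2 n).2 hn.two_dvd
  calc _ = ∑ j ∈ Finset.range M, ∑ d ∈ Finset.range M,
        (if Q (d + j) then y ^ (d + j) else 0) * (if Q j then z ^ j else 0) := by
        rw [Finset.mul_sum]
        refine Finset.sum_congr rfl fun j _ => ?_
        rw [← hper.sum_range_add j, Finset.sum_mul]
    _ = ∑ d ∈ Finset.range M,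
        (((Finset.range M).filter fun j => Q j ∧ Q (j + d)).card : A) * y ^ d := by
        rw [Finset.sum_comm]
        refine Finset.sum_congr rfl fun d _ => ?_
        rw [Finset.card_filter, Nat.cast_sum, Finset.sum_mul]
        refine Finset.sum_congr rfl fun j _ => ?_
        have h1 : y ^ (d + j) * z ^ j = y ^ d := by
          rw [pow_add, mul_assoc, ← mul_pow, hyz, one_pow, mul_one]
        rw [add_comm j d]
        by_cases h2 : Q j <;> by_cases h3 : Q (d + j) <;> simp [h2, h3, h1]
    _ = (((Finset.range M).filter fun j => Q j ∧ Q (j + 0)).card : A) * y ^ 0 := by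
        refine Finset.sum_eq_single 0 (fun d hdM hd0 => ?_) fun h => ?_
        · rw [hcast (hd d (Nat.pos_of_ne_zero hd0) (Finset.mem_range.1 hdM)), zero_mul]
        · exact absurd (Finset.mem_range.2 hM) h
    _ = 1 := by
        simp only [add_zero, and_self, pow_zero, mul_one]
        obtain ⟨k, hk⟩ := h0
        rw [hk, Nat.cast_add, hcast (even_two_mul k), Nat.cast_one, zero_add]

/-! ### The zeros of the trace along the powers of a primitive element -/

theorem AddMonoidHom.card_filter_mem_of_surjective {G H : Type*} [AddGroup G] [AddGroup H]
    [Fintype G] [DecidableEq H] (φ : G →+ H) (hφ : Function.Surjective φ) (S : Finset H) :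
    (Finset.univ.filter fun x => φ x ∈ S).card =
      S.card * (Finset.univ.filter fun x => φ x = 0).card := by
  rw [Finset.card_eq_sum_card_fiberwise (f := φ) (t := S) fun x hx => by simpa using hx,
    Finset.sum_const_nat]
  intro b hb
  rw [Finset.filter_filter]
  have h : ∀ x, (φ x ∈ S ∧ φ x = b) ↔ φ x = b := fun x =>
    ⟨fun h => h.2, fun h => ⟨h ▸ hb, h⟩⟩
  simp only [h]
  exact AddMonoidHom.card_fiber_eq_of_mem_range φ (hφ b) (hφ 0)

section Trace

variable {p : ℕ} [Fact p.Prime] {K : Type*} [Field K] [Algebra (ZMod p) K] [Finite K]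

/-- For `a` outside the prime field, the two functionals `Tr x` and `Tr (a * x)` are linearly
independent. -/
theorem surjective_trace_prod_trace_mul {a : K}
    (ha : a ∉ (algebraMap (ZMod p) K).range) :
    Function.Surjective ((Algebra.trace (ZMod p) K).prod
      (Algebra.trace (ZMod p) K ∘ₗ LinearMap.mulLeft (ZMod p) a)) := by
  rw [← LinearMap.range_eq_top]
  by_contra hne
  obtain ⟨φ, hφ0, hφ⟩ := Submodule.exists_le_ker_of_lt_top _ (lt_top_iff_ne_top.2 hne)
  set c := φ (1, 0)
  set d := φ (0, 1)
  have hφcd : ∀ u v, φ (u, v) = u * c + v * d := fun u v => by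
    have : (u, v) = u • ((1, 0) : ZMod p × ZMod p) + v • ((0, 1) : ZMod p × ZMod p) := by simp
    rw [this, map_add, map_smul, map_smul, smul_eq_mul, smul_eq_mul]
  have htr : ∀ x, Algebra.trace (ZMod p) K
      ((algebraMap (ZMod p) K c + algebraMap (ZMod p) K d * a) * x) = 0 := fun x => by
    have h1 := hφ (LinearMap.mem_range_self _ x)
    rw [LinearMap.mem_ker] at h1
    replace h1 := (hφcd _ _).symm.trans h1
    rw [add_mul, mul_assoc, map_add, ← Algebra.smul_def, ← Algebra.smul_def, map_smul, map_smul,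
      smul_eq_mul, smul_eq_mul, mul_comm c, mul_comm d]
    exact h1
  have hz : algebraMap (ZMod p) K c + algebraMap (ZMod p) K d * a = 0 := by
    by_contra hz
    have htop : Function.Surjective (Algebra.trace (ZMod p) K) := Algebra.trace_surjective _ _
    obtain ⟨y, hy⟩ := htop 1
    have := htr ((algebraMap (ZMod p) K c + algebraMap (ZMod p) K d * a)⁻¹ * y)
    rw [mul_inv_cancel_left₀ hz, hy] at this
    exact one_ne_zero this
  by_cases hd : d = 0
  · have hc : c = 0 := by
      rw [hd, map_zero, zero_mul, add_zero] at hz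
      exact (map_eq_zero _).1 hz
    exact hφ0 (LinearMap.ext fun x => by
      rw [show x = (x.1, x.2) from rfl, hφcd, hc, hd]; simp)
  · refine ha ⟨-c / d, ?_⟩
    have hd' : algebraMap (ZMod p) K d ≠ 0 := by simpa using hd
    rw [map_div₀, map_neg, div_eq_iff hd']
    linear_combination -hz

theorem card_filter_trace_ne_zero [Fintype K] :
    (Finset.univ.filter fun x : K => Algebra.trace (ZMod p) K x ≠ 0).card =
      (p - 1) * (Finset.univ.filter fun x : K => Algebra.trace (ZMod p) K x = 0).card := by
  have h := (Algebra.trace (ZMod p) K).toAddMonoidHom.card_filter_mem_of_surjective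
    (Algebra.trace_surjective (ZMod p) K) (Finset.univ.erase 0)
  rw [Finset.card_erase_of_mem (Finset.mem_univ _), Finset.card_univ, ZMod.card] at h
  refine (congrArg Finset.card (Finset.filter_congr fun x _ => ?_)).trans h
  simp

theorem card_filter_trace_ne_zero_and [Fintype K] {a : K}
    (ha : a ∉ (algebraMap (ZMod p) K).range) :
    ∃ k, (Finset.univ.filter fun x : K => Algebra.trace (ZMod p) K x ≠ 0 ∧
      Algebra.trace (ZMod p) K (a * x) ≠ 0).card = (p - 1) * (p - 1) * k := by
  have h := AddMonoidHom.card_filter_mem_of_surjective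
    ((Algebra.trace (ZMod p) K).prod
      (Algebra.trace (ZMod p) K ∘ₗ LinearMap.mulLeft (ZMod p) a)).toAddMonoidHom
    (surjective_trace_prod_trace_mul ha)
    ((Finset.univ.erase (0 : ZMod p)) ×ˢ (Finset.univ.erase (0 : ZMod p)))
  rw [Finset.card_product, Finset.card_erase_of_mem (Finset.mem_univ _), Finset.card_univ,
    ZMod.card] at h
  refine ⟨_, (congrArg Finset.card (Finset.filter_congr fun x _ => ?_)).trans h⟩
  simp

theorem odd_card_filter_trace_eq_zero (hp : p ≠ 2) [Fintype K] :
    Odd (Finset.univ.filter fun x : K => Algebra.trace (ZMod p) K x = 0).card := by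
  have h := (Algebra.trace (ZMod p) K).toAddMonoidHom.card_filter_mem_of_surjective
    (Algebra.trace_surjective (ZMod p) K) Finset.univ
  have hodd : Odd (Fintype.card K) := by
    rw [Module.card_eq_pow_finrank (K := ZMod p) (V := K), ZMod.card]
    exact ((Fact.out : p.Prime).odd_of_ne_two hp).pow
  simp only [Finset.mem_univ, Finset.filter_true, Finset.card_univ] at h
  rw [h] at hodd
  exact (Nat.odd_mul.1 hodd).2

end Trace

theorem orderOf_primitive {K : Type*} [Field K] [Finite K] {ω : Kˣ} {k M : ℕ}
    (hω : ∀ x : Kˣ, x ∈ Subgroup.zpowers ω) (hM : M * k = Nat.card K - 1) :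
    orderOf ω = k * M := by
  rw [orderOf_eq_card_of_forall_mem_zpowers hω, Nat.card_units, ← hM, mul_comm]

theorem card_filter_primitive {K : Type*} [Field K] [Fintype K] {ω : Kˣ} {k M : ℕ}
    (hω : ∀ x : Kˣ, x ∈ Subgroup.zpowers ω) (hM : M * k = Nat.card K - 1)
    (Q : K → Prop) [DecidablePred Q] (hQ : ¬ Q 0) :
    (Finset.univ.filter Q).card =
      ((Finset.range (k * M)).filter fun n => Q ((ω : K) ^ n)).card := by
  classical
  symm
  have hord := orderOf_primitive hω hM
  refine Finset.card_bij (fun n _ => (ω : K) ^ n) (fun n hn => ?_) (fun i hi j hj h => ?_)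
    fun x hx => ?_
  · simpa using (Finset.mem_filter.1 hn).2
  · have hi := Finset.mem_range.1 (Finset.mem_filter.1 hi).1
    have hj := Finset.mem_range.1 (Finset.mem_filter.1 hj).1
    rw [← hord] at hi hj
    refine pow_injOn_Iio_orderOf hi hj (Units.ext ?_)
    simpa using h
  · have hx := (Finset.mem_filter.1 hx).2
    have hx0 : x ≠ 0 := by rintro rfl; exact hQ hx
    have hmem := IsCyclic.image_range_orderOf hω ▸ Finset.mem_univ (Units.mk0 x hx0)
    obtain ⟨n, hn, hnx⟩ := Finset.mem_image.1 hmem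
    have hnx' : (ω : K) ^ n = x := by
      rw [← Units.val_pow_eq_pow_val, hnx, Units.val_mk0]
    exact ⟨n, Finset.mem_filter.2 ⟨hord ▸ hn, hnx'.symm ▸ hx⟩, hnx'⟩

section Primitive

variable {p : ℕ} [Fact p.Prime] {K : Type*} [Field K] [Algebra (ZMod p) K] {ω : Kˣ}

theorem traceLegendre_eq (n : ℕ) : traceLegendre p ω n =
    quadraticChar (ZMod p) (Algebra.trace (ZMod p) K ((ω : K) ^ n)) := by
  simp [traceLegendre, legendreSym]

theorem traceLegendre_eq_zero_iff (n : ℕ) :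
    traceLegendre p ω n = 0 ↔ Algebra.trace (ZMod p) K ((ω : K) ^ n) = 0 := by
  rw [traceLegendre_eq, quadraticChar_eq_zero_iff]

theorem traceLegendre_trichotomy (n : ℕ) :
    traceLegendre p ω n = 0 ∨ traceLegendre p ω n = 1 ∨ traceLegendre p ω n = -1 := by
  by_cases h : Algebra.trace (ZMod p) K ((ω : K) ^ n) = 0
  · exact Or.inl ((traceLegendre_eq_zero_iff n).2 h)
  · rw [traceLegendre_eq]
    exact Or.inr (quadraticChar_dichotomy h)

variable [Finite K] {M : ℕ}

/-- `ω ^ M` is the norm of `ω`; since the norm is surjective, it is a generator of the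
multiplicative group of the prime field and in particular a nonsquare. -/
theorem exists_nonsquare_eq_pow (hp : p ≠ 2) (hω : ∀ x : Kˣ, x ∈ Subgroup.zpowers ω)
    (hM : M * (p - 1) = Nat.card K - 1) :
    ∃ g : ZMod p, quadraticChar (ZMod p) g = -1 ∧ algebraMap (ZMod p) K g = (ω : K) ^ M := by
  have hp1 : 0 < p - 1 := Nat.sub_pos_of_lt (Fact.out : p.Prime).one_lt
  refine ⟨Algebra.norm (ZMod p) (ω : K), ?_, ?_⟩
  · obtain ⟨a, ha⟩ := quadraticChar_exists_neg_one (F := ZMod p) (by rwa [ZMod.ringChar_zmod_n])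
    have ha0 : a ≠ 0 := by rintro rfl; simp at ha
    obtain ⟨x, rfl⟩ := FiniteField.norm_surjective (ZMod p) K a
    have hx0 : x ≠ 0 := by rintro rfl; simp at ha0
    obtain ⟨n, hn⟩ := (mem_powers_iff_mem_zpowers (x := ω)).2 (hω (Units.mk0 x hx0))
    have hnx : (ω : K) ^ n = x := by
      rw [← Units.val_pow_eq_pow_val]
      exact congrArg Units.val hn
    rw [← hnx, map_pow, map_pow] at ha
    have hg : Algebra.norm (ZMod p) (ω : K) ≠ 0 := by simp
    refine (quadraticChar_dichotomy hg).resolve_left fun h => ?_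
    rw [h, one_pow] at ha
    norm_num at ha
  · rw [FiniteField.algebraMap_norm_eq_pow, Nat.card_zmod, ← hM, Nat.mul_div_cancel _ hp1]

theorem traceLegendre_antiperiodic (hp : p ≠ 2) (hω : ∀ x : Kˣ, x ∈ Subgroup.zpowers ω)
    (hM : M * (p - 1) = Nat.card K - 1) : Function.Antiperiodic (traceLegendre p ω) M := fun n => by
  obtain ⟨g, hg, hgω⟩ := exists_nonsquare_eq_pow hp hω hM
  rw [traceLegendre_eq, traceLegendre_eq, pow_add, ← hgω, mul_comm, ← Algebra.smul_def, map_smul,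
    smul_eq_mul, map_mul, hg, neg_one_mul]

theorem periodic_trace_ne_zero (hp : p ≠ 2) (hω : ∀ x : Kˣ, x ∈ Subgroup.zpowers ω)
    (hM : M * (p - 1) = Nat.card K - 1) :
    Function.Periodic (fun n => Algebra.trace (ZMod p) K ((ω : K) ^ n) ≠ 0) M := fun n => by
  simp only [ne_eq, ← traceLegendre_eq_zero_iff, traceLegendre_antiperiodic hp hω hM n,
    neg_eq_zero]

theorem geomSeq₁_add (hp : p ≠ 2) (hω : ∀ x : Kˣ, x ∈ Subgroup.zpowers ω)
    (hM : M * (p - 1) = Nat.card K - 1) (n : ℕ) : geomSeq₁ p ω n + geomSeq₁ p ω (n + M) =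
      if Algebra.trace (ZMod p) K ((ω : K) ^ n) ≠ 0 then 1 else 0 := by
  rw [geomSeq₁, geomSeq₁, traceLegendre_antiperiodic hp hω hM n]
  simp only [ne_eq, ← traceLegendre_eq_zero_iff]
  rcases traceLegendre_trichotomy (p := p) (ω := ω) n with h | h | h <;> rw [h] <;> decide

theorem geomSeq₂_add (hp : p ≠ 2) (hω : ∀ x : Kˣ, x ∈ Subgroup.zpowers ω)
    (hM : M * (p - 1) = Nat.card K - 1) (n : ℕ) : geomSeq₂ p ω n + geomSeq₂ p ω (n + M) =
      if Algebra.trace (ZMod p) K ((ω : K) ^ n) ≠ 0 then 1 else 0 := by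
  rw [geomSeq₂, geomSeq₂, traceLegendre_antiperiodic hp hω hM n]
  simp only [ne_eq, ← traceLegendre_eq_zero_iff]
  rcases traceLegendre_trichotomy (p := p) (ω := ω) n with h | h | h <;> rw [h] <;> decide

/-- The powers of `ω` pass `p - 1` times through the residues modulo `M`, so this number is
`(p - 1)⁻¹ * #{x | Tr x ≠ 0} = #(ker Tr)`, a divisor of `#K`. -/
theorem odd_card_trace_ne_zero (hp : p ≠ 2) (hω : ∀ x : Kˣ, x ∈ Subgroup.zpowers ω)
    (hM : M * (p - 1) = Nat.card K - 1) :
    Odd ((Finset.range M).filter fun n => Algebra.trace (ZMod p) K ((ω : K) ^ n) ≠ 0).card := by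
  have := Fintype.ofFinite K
  have hp1 : 0 < p - 1 := Nat.sub_pos_of_lt (Fact.out : p.Prime).one_lt
  have h := card_filter_trace_ne_zero (p := p) (K := K)
  rw [card_filter_primitive hω hM _ (by simp),
    (periodic_trace_ne_zero hp hω hM).card_filter_range_mul] at h
  rw [Nat.eq_of_mul_eq_mul_left hp1 h]
  exact odd_card_filter_trace_eq_zero hp

/-- For `0 < d < M` the element `ω ^ d` lies outside the prime field, so `p - 1` times this number
is the number of `x` with `Tr x ≠ 0` and `Tr (ω ^ d * x) ≠ 0`, a multiple of `(p - 1) ^ 2`. -/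
theorem even_card_trace_ne_zero_and (hp : p ≠ 2) (hω : ∀ x : Kˣ, x ∈ Subgroup.zpowers ω)
    (hM : M * (p - 1) = Nat.card K - 1) (d : ℕ) (hd0 : 0 < d) (hdM : d < M) :
    Even ((Finset.range M).filter fun n => Algebra.trace (ZMod p) K ((ω : K) ^ n) ≠ 0 ∧
      Algebra.trace (ZMod p) K ((ω : K) ^ (n + d)) ≠ 0).card := by
  have := Fintype.ofFinite K
  have hp1 : 0 < p - 1 := Nat.sub_pos_of_lt (Fact.out : p.Prime).one_lt
  have hω_not_mem : (ω : K) ^ d ∉ (algebraMap (ZMod p) K).range := by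
    rintro ⟨c, hc⟩
    have hc0 : c ≠ 0 := by
      rintro rfl
      rw [map_zero] at hc
      exact pow_ne_zero d ω.ne_zero hc.symm
    have h1 : ω ^ (d * (p - 1)) = 1 := by
      ext
      rw [Units.val_pow_eq_pow_val, pow_mul, ← hc, ← map_pow, ZMod.pow_card_sub_one_eq_one hc0,
        map_one, Units.val_one]
    have h2 := orderOf_dvd_of_pow_eq_one h1
    rw [orderOf_primitive hω hM, mul_comm] at h2
    exact absurd (Nat.le_of_dvd hd0 (Nat.dvd_of_mul_dvd_mul_right hp1 h2)) (not_le.2 hdM)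
  obtain ⟨k, hk⟩ := card_filter_trace_ne_zero_and hω_not_mem
  have hper : Function.Periodic (fun n => Algebra.trace (ZMod p) K ((ω : K) ^ n) ≠ 0 ∧
      Algebra.trace (ZMod p) K ((ω : K) ^ d * (ω : K) ^ n) ≠ 0) M := fun n => by
    have h := periodic_trace_ne_zero hp hω hM
    have h1 := h n
    have h2 := h (d + n)
    simp only [← pow_add, ← add_assoc] at h1 h2 ⊢
    rw [h1, h2]
  rw [card_filter_primitive hω hM _ (by simp), hper.card_filter_range_mul, mul_assoc] at hk
  have h3 := Nat.eq_of_mul_eq_mul_left hp1 hk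
  simp only [← pow_add, add_comm d] at h3
  rw [h3]
  exact (((Fact.out : p.Prime).even_sub_one hp)).mul_right k

end Primitive

/-! ### Interleaving two complementary pairs -/

theorem Finset.sum_range_two_mul {A : Type*} [AddCommMonoid A] (f : ℕ → A) (n : ℕ) :
    ∑ i ∈ range (2 * n), f i =
      ∑ i ∈ range n, f (2 * i) + ∑ i ∈ range n, f (2 * i + 1) := by
  induction n with
  | zero => simp
  | succ n ih =>
    rw [mul_add, mul_one, sum_range_succ, sum_range_succ, ih, sum_range_succ, sum_range_succ,
      add_add_add_comm, add_assoc]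

theorem interleave_two_even {α : Type*} (a b : ℕ → α) (j : ℕ) :
    interleave ![a, b] (2 * j) = a j := by
  simpa [mul_comm] using interleave_apply ![a, b] 0 j

theorem interleave_two_odd {α : Type*} (a b : ℕ → α) (j : ℕ) :
    interleave ![a, b] (2 * j + 1) = b j := by
  simpa [mul_comm] using interleave_apply ![a, b] 1 j

theorem Function.Periodic.interleave_two {α : Type*} {a b : ℕ → α} {N : ℕ}
    (ha : Function.Periodic a N) (hb : Function.Periodic b N) :
    Function.Periodic (interleave ![a, b]) (2 * N) := fun n => by
  obtain ⟨j, rfl | rfl⟩ := n.even_or_odd'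
  · rw [← mul_add, interleave_two_even, interleave_two_even, ha]
  · rw [add_right_comm, ← mul_add, interleave_two_odd, interleave_two_odd, hb]

section Eval

variable {A : Type*} [CommRing A] {β γ : A}

theorem aeval_periodPoly {F : Type*} [Field F] [Algebra F A] (hβγ : β * γ = 1) {P : ℕ}
    (hβ : β ^ P = 1) (s : ℕ → F) :
    aeval β (periodPoly s P) = ∑ j ∈ Finset.range P, algebraMap F A (s j) * γ ^ j := by
  rw [periodPoly, map_sum]
  refine Finset.sum_congr rfl fun j hj => ?_
  rw [aeval_monomial]
  congr 1
  calc β ^ (P - j) = β ^ (P - j) * (β ^ j * γ ^ j) := by rw [← mul_pow, hβγ, one_pow, mul_one]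
    _ = γ ^ j := by
      rw [← mul_assoc, ← pow_add, Nat.sub_add_cancel (Finset.mem_range.1 hj).le, hβ, one_mul]

/-- Over `ZMod 2` and for even `P`, the derivative of the period polynomial retains exactly the
terms of odd index. -/
theorem mul_aeval_derivative_periodPoly [Algebra (ZMod 2) A] (hβγ : β * γ = 1) {N : ℕ}
    (hβ : β ^ (2 * N) = 1) (s : ℕ → ZMod 2) :
    β * aeval β (derivative (periodPoly s (2 * N))) =
      γ * ∑ j ∈ Finset.range N, algebraMap (ZMod 2) A (s (2 * j + 1)) * (γ ^ 2) ^ j := by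
  have h : X * derivative (periodPoly s (2 * N)) =
      periodPoly (fun j => s j * (j : ZMod 2)) (2 * N) := by
    simp only [periodPoly, derivative_sum, Finset.mul_sum]
    refine Finset.sum_congr rfl fun j hj => ?_
    have hj := Finset.mem_range.1 hj
    have hcast : ((2 * N - j : ℕ) : ZMod 2) = j := by
      rw [Nat.cast_sub hj.le, Nat.cast_mul, show ((2 : ℕ) : ZMod 2) = 0 from rfl, zero_mul,
        zero_sub, ZModModule.neg_eq_self]
    rw [derivative_monomial, X_mul_monomial, hcast, show 2 * N - j - 1 + 1 = 2 * N - j by omega]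
  have h1 := congrArg (aeval β) h
  rw [map_mul, aeval_X, aeval_periodPoly hβγ hβ, Finset.sum_range_two_mul] at h1
  rw [h1, Finset.mul_sum]
  have h0 : ((2 : ℕ) : ZMod 2) = 0 := rfl
  simp only [Nat.cast_add, Nat.cast_mul, h0, zero_mul, mul_zero, map_zero, Finset.sum_const_zero,
    zero_add, Nat.cast_one, mul_one]
  refine Finset.sum_congr rfl fun j _ => ?_
  ring

theorem aeval_periodPoly_interleave {F : Type*} [Field F] [Algebra F A] (hβγ : β * γ = 1) {N : ℕ}
    (hβ : β ^ (2 * N) = 1) (a b : ℕ → F) :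
    aeval β (periodPoly (interleave ![a, b]) (2 * N)) =
      ∑ j ∈ Finset.range N, algebraMap F A (a j) * (γ ^ 2) ^ j +
      γ * ∑ j ∈ Finset.range N, algebraMap F A (b j) * (γ ^ 2) ^ j := by
  rw [aeval_periodPoly hβγ hβ, Finset.sum_range_two_mul, Finset.mul_sum]
  simp only [interleave_two_even, interleave_two_odd]
  congr 1 <;> refine Finset.sum_congr rfl fun j _ => ?_ <;> ring

/-- Folding a sum of length `2 * M` at an `M`-th root of unity: only the sums `t j + t (j + M)`
matter. -/
theorem sum_range_two_mul_fold [Algebra (ZMod 2) A] {Q : ℕ → Prop} [DecidablePred Q] {M : ℕ}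
    {t : ℕ → ZMod 2} (ht : ∀ n, t n + t (n + M) = if Q n then 1 else 0) {y : A} (hy : y ^ M = 1) :
    ∑ j ∈ Finset.range (2 * M), algebraMap (ZMod 2) A (t j) * y ^ j =
      ∑ j ∈ Finset.range M, if Q j then y ^ j else 0 := by
  rw [two_mul, Finset.sum_range_add, ← Finset.sum_add_distrib]
  refine Finset.sum_congr rfl fun j _ => ?_
  rw [pow_add, hy, one_mul, ← add_mul, ← map_add, add_comm M, ht]
  split_ifs <;> simp

end Eval

/-- Two binary sequences `t`, `u`, each of which is complemented by the translation by `M`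
exactly at the indices satisfying `Q`, where the indicator of `Q` is `M`-periodic with odd
autocorrelation at shift `0` and even autocorrelation elsewhere. These are the only properties
of the two geometric sequences on which the minimal polynomial depends. -/
structure IsComplementPair (t u : ℕ → ZMod 2) (Q : ℕ → Prop) [DecidablePred Q] (M : ℕ) : Prop where
  pos : 0 < M
  left : ∀ n, t n + t (n + M) = if Q n then 1 else 0
  right : ∀ n, u n + u (n + M) = if Q n then 1 else 0
  periodic : Function.Periodic Q M
  odd_card : Odd ((Finset.range M).filter Q).card
  even_card : ∀ d, 0 < d → d < M →
    Even ((Finset.range M).filter fun j => Q j ∧ Q (j + d)).card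

namespace IsComplementPair

theorem periodic_of_fold {Q : ℕ → Prop} [DecidablePred Q] {M : ℕ}
    {t : ℕ → ZMod 2} (hQ : Function.Periodic Q M)
    (ht : ∀ n, t n + t (n + M) = if Q n then 1 else 0) : Function.Periodic t (2 * M) := fun n => by
  have h := (ht n).trans ((ht (n + M)).trans (by simp only [hQ n])).symm
  rw [add_comm (t n), add_right_inj, add_assoc, ← two_mul] at h
  exact h.symm

variable {t u : ℕ → ZMod 2} {Q : ℕ → Prop} [DecidablePred Q] {M : ℕ}

theorem right_shift (h : IsComplementPair t u Q M) (e n : ℕ) :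
    leftShift e u n + leftShift e u (n + M) = if Q (n + e) then 1 else 0 := by
  rw [leftShift, leftShift, add_right_comm, h.right]

theorem periodic_interleave (h : IsComplementPair t u Q M) (e : ℕ) :
    Function.Periodic (interleave ![t, leftShift e u]) (2 * (2 * M)) :=
  (periodic_of_fold h.periodic h.left).interleave_two
    (periodic_of_fold (fun n => by rw [add_right_comm, h.periodic]) (h.right_shift e))

/-- At an `M`-th root of unity `β` with inverse `γ`, the period polynomial of the interleaved
sequence is a unit times `γ ^ (2 * e) + γ`, and its derivative is a unit. -/
theorem exists_isUnit_aeval {A : Type*} [CommRing A] [Algebra (ZMod 2) A] [CharP A 2]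
    (h : IsComplementPair t u Q M) (e : ℕ) {β γ : A} (hβγ : β * γ = 1) (hβ : β ^ M = 1) :
    ∃ v : A, IsUnit v ∧
      aeval β (periodPoly (interleave ![t, leftShift e u]) (2 * (2 * M))) =
        v * (γ ^ (2 * e) + γ) ∧
      β * aeval β (derivative (periodPoly (interleave ![t, leftShift e u]) (2 * (2 * M)))) =
        γ * v := by
  have hγ : γ ^ M = 1 := by
    simpa [hβγ, hβ] using (mul_pow β γ M).symm
  have hy : (γ ^ 2) ^ M = 1 := by rw [← pow_mul, mul_comm, pow_mul, hγ, one_pow]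
  have hβP : β ^ (2 * (2 * M)) = 1 := by
    rw [← mul_assoc, mul_comm, pow_mul, hβ, one_pow]
  set v := ∑ j ∈ Finset.range M, if Q (j + e) then (γ ^ 2) ^ j else 0 with hv
  have hper : Function.Periodic (fun i => if Q i then (γ ^ 2) ^ i else 0) M := fun i => by
    simp only [h.periodic i, pow_add _ i, hy, mul_one]
  have hW : ∑ j ∈ Finset.range M, (if Q j then (γ ^ 2) ^ j else 0) = γ ^ (2 * e) * v := by
    rw [← hper.sum_range_add e, hv, Finset.mul_sum]
    refine Finset.sum_congr rfl fun j _ => ?_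
    rw [mul_ite, mul_zero, pow_mul, pow_add _ j, mul_comm]
  refine ⟨v, ?_, ?_, ?_⟩
  · have h1 := sum_pow_mul_sum_pow_eq_one h.pos h.periodic h.odd_card h.even_card
      (y := γ ^ 2) (z := β ^ 2) (by rw [← mul_pow, mul_comm, hβγ, one_pow]) hy
    rw [hW, mul_assoc, mul_left_comm] at h1
    exact IsUnit.of_mul_eq_one _ h1
  · rw [aeval_periodPoly_interleave hβγ hβP, sum_range_two_mul_fold h.left hy,
      sum_range_two_mul_fold (h.right_shift e) hy, hW]
    ring
  · rw [mul_aeval_derivative_periodPoly hβγ hβP]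
    simp only [interleave_two_odd]
    rw [sum_range_two_mul_fold (h.right_shift e) hy]

end IsComplementPair

/-! ### The greatest common divisor with `X ^ (2 * N) - 1` -/

theorem gcdParam_dvd {M : ℕ} (hM : 0 < M) (e : ℕ) :
    (2 * M) / 2 ^ padicValNat 2 (2 * M) ∣ M ∧
    gcdParam (2 * M) e ∣ (2 * M) / 2 ^ padicValNat 2 (2 * M) ∧ Odd (gcdParam (2 * M) e) := by
  have h0 : 2 * M ≠ 0 := by omega
  have hcop : Nat.Coprime 2 (2 * M / 2 ^ padicValNat 2 (2 * M)) := by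
    rw [← Nat.factorization_def _ Nat.prime_two]
    exact Nat.coprime_ordCompl Nat.prime_two h0
  have hdvd : gcdParam (2 * M) e ∣ 2 * M / 2 ^ padicValNat 2 (2 * M) := Nat.gcd_dvd_left _ _
  refine ⟨?_, hdvd, ?_⟩
  · refine hcop.symm.dvd_of_dvd_mul_left ?_
    exact Nat.div_dvd_of_dvd pow_padicValNat_dvd
  · exact Nat.coprime_two_left.1 (hcop.coprime_dvd_right hdvd)

/-- Among the roots of unity of order dividing the odd part of `2 * M`, those of order dividing
`gcdParam` are the ones with `γ ^ (2 * e - 1) = 1`. -/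
theorem pow_gcdParam_eq_one_iff {A : Type*} [CommRing A] {M : ℕ} (hM : 0 < M) (e : ℕ) {β γ : A}
    (hβγ : β * γ = 1) :
    γ ^ gcdParam (2 * M) e = 1 ↔
      γ ^ ((2 * M) / 2 ^ padicValNat 2 (2 * M)) = 1 ∧ γ ^ (2 * e) = γ := by
  set n := (2 * M) / 2 ^ padicValNat 2 (2 * M) with hn
  have hn0 : 0 < n := Nat.pos_of_dvd_of_pos (gcdParam_dvd hM e).1 hM
  set u := posMod (-2 * (e : ℤ) + 1) n with hu
  have hmod : u + 2 * e ≡ 1 [MOD n] := by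
    have h := (posMod_modEq (-2 * (e : ℤ) + 1) hn0).add_right (2 * (e : ℤ))
    rw [← Int.natCast_modEq_iff]
    push_cast
    convert h using 1
    ring
  rw [show gcdParam (2 * M) e = n.gcd u from rfl, pow_gcd_eq_one]
  refine and_congr_right fun hγ => ?_
  have h1 : γ ^ u * γ ^ (2 * e) = γ := by
    rw [← pow_add, pow_eq_pow_of_modEq hmod hγ, pow_one]
  have hunit : IsUnit γ := IsUnit.of_mul_eq_one _ ((mul_comm γ β).trans hβγ)
  constructor
  · intro h
    rwa [h, one_mul] at h1
  · intro h
    rw [h] at h1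
    exact hunit.mul_right_cancel (h1.trans (one_mul γ).symm)

theorem X_pow_sub_one_monic {F : Type*} [Field F] {n : ℕ} (hn : 0 < n) :
    (X ^ n - 1 : F[X]).Monic := by
  simpa using monic_X_pow_sub_C (1 : F) hn.ne'

theorem X_pow_sub_one_natDegree {F : Type*} [Field F] {n : ℕ} :
    (X ^ n - 1 : F[X]).natDegree = n := by
  simpa using natDegree_X_pow_sub_C (n := n) (r := (1 : F))

theorem pow_eq_one_of_mul_eq_one {A : Type*} [CommRing A] {β γ : A} (hβγ : β * γ = 1) (n : ℕ) :
    γ ^ n = 1 ↔ β ^ n = 1 := by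
  have h := mul_pow β γ n
  rw [hβγ, one_pow] at h
  constructor <;> intro h1 <;> simpa [h1] using h.symm

namespace IsComplementPair

variable {t u : ℕ → ZMod 2} {Q : ℕ → Prop} [DecidablePred Q] {M : ℕ}

theorem X_pow_gcdParam_sub_one_dvd_periodPoly (h : IsComplementPair t u Q M) (e : ℕ) :
    X ^ gcdParam (2 * M) e - 1 ∣
      periodPoly (interleave ![t, leftShift e u]) (2 * (2 * M)) := by
  obtain ⟨hnM, hGn, hG⟩ := gcdParam_dvd h.pos e
  set G := gcdParam (2 * M) e with hGdef
  -- evaluate at the tautological root in the quotient by `X ^ G - 1`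
  have hnt : Nontrivial (AdjoinRoot (X ^ G - 1 : (ZMod 2)[X])) :=
    AdjoinRoot.nontrivial _ (natDegree_pos_iff_degree_pos.1
      (by rw [X_pow_sub_one_natDegree]; exact hG.pos)).ne'
  have hchar : CharP (AdjoinRoot (X ^ G - 1 : (ZMod 2)[X])) 2 :=
    charP_of_injective_algebraMap (algebraMap (ZMod 2) _).injective 2
  set β := AdjoinRoot.root (X ^ G - 1 : (ZMod 2)[X]) with hβdef
  have hβ : β ^ G = 1 := by
    have := AdjoinRoot.aeval_eq (f := (X ^ G - 1 : (ZMod 2)[X])) (X ^ G - 1)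
    rw [AdjoinRoot.mk_self, map_sub, map_pow, aeval_X, map_one] at this
    exact sub_eq_zero.1 this
  have hβγ : β * β ^ (G - 1) = 1 := by
    rw [← pow_succ', Nat.sub_add_cancel hG.pos, hβ]
  have hβM : β ^ M = 1 := by
    obtain ⟨k, hk⟩ := hGn.trans hnM
    rw [hk, pow_mul, hβ, one_pow]
  obtain ⟨v, -, hv, -⟩ := h.exists_isUnit_aeval e hβγ hβM
  have hγ := ((pow_gcdParam_eq_one_iff h.pos e hβγ).1
    ((pow_eq_one_of_mul_eq_one hβγ _).2 hβ)).2
  rw [hγ, ZModModule.add_self, mul_zero, AdjoinRoot.aeval_eq, AdjoinRoot.mk_eq_zero] at hv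
  exact hv

/-- Cofactors of `X ^ G - 1` in `X ^ (2 * N) - 1` and in the period polynomial are coprime: a
common root would be a multiple root of the period polynomial, contradicting the nonvanishing of
the derivative. -/
theorem isCoprime_cofactors (h : IsComplementPair t u Q M) (e : ℕ) {q r : (ZMod 2)[X]}
    (hq : X ^ (2 * (2 * M)) - 1 = (X ^ gcdParam (2 * M) e - 1) * q)
    (hr : periodPoly (interleave ![t, leftShift e u]) (2 * (2 * M)) =
      (X ^ gcdParam (2 * M) e - 1) * r) : IsCoprime q r := by
  rw [isCoprime_iff_aeval_ne_zero]
  intro A _ _ _ β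
  by_contra! hcon
  obtain ⟨hβq, hβr⟩ := hcon
  have hchar : CharP A 2 := charP_of_injective_algebraMap (algebraMap (ZMod 2) A).injective 2
  obtain ⟨hnM, -, -⟩ := gcdParam_dvd h.pos e
  have hβP : β ^ (2 * (2 * M)) = 1 := by
    have := congrArg (aeval β) hq
    rw [map_mul, hβq, mul_zero, map_sub, map_pow, aeval_X, map_one] at this
    exact sub_eq_zero.1 this
  -- in characteristic two the order of `β` divides the odd part of `2 * M`
  have hβn : β ^ (2 * M / 2 ^ padicValNat 2 (2 * M)) = 1 := by
    rw [← Nat.mul_div_cancel' (pow_padicValNat_dvd (p := 2) (n := 2 * M)), ← mul_assoc,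
      ← pow_succ'] at hβP
    exact (ExpChar.pow_prime_pow_mul_eq_one_iff 2 _ _ β).1 hβP
  have hβM : β ^ M = 1 := by
    obtain ⟨k, hk⟩ := hnM
    rw [hk, pow_mul, hβn, one_pow]
  have hβγ : β * β ^ (M - 1) = 1 := by
    rw [← pow_succ', Nat.sub_add_cancel h.pos, hβM]
  obtain ⟨v, hvu, hv, hv'⟩ := h.exists_isUnit_aeval e hβγ hβM
  set γ := β ^ (M - 1)
  have hγ : γ ^ (2 * e) = γ := by
    rw [hr, map_mul, hβr, mul_zero, eq_comm, hvu.mul_right_eq_zero] at hv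
    rw [eq_neg_of_add_eq_zero_left hv, ZModModule.neg_eq_self]
  have hβG : β ^ gcdParam (2 * M) e = 1 := by
    rw [← pow_eq_one_of_mul_eq_one hβγ, pow_gcdParam_eq_one_iff h.pos e hβγ]
    exact ⟨(pow_eq_one_of_mul_eq_one hβγ _).2 hβn, hγ⟩
  have hγu : IsUnit γ := IsUnit.of_mul_eq_one _ ((mul_comm γ β).trans hβγ)
  refine (hγu.mul hvu).ne_zero ?_
  have hroot : aeval β (X ^ gcdParam (2 * M) e - 1 : (ZMod 2)[X]) = 0 := by
    rw [map_sub, map_pow, aeval_X, map_one, hβG, sub_self]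
  rw [← hv', hr, derivative_mul, map_add, map_mul, map_mul, hβr, hroot, mul_zero, zero_mul,
    add_zero, mul_zero]

theorem isMinimalPolynomial_iff_and_linearComplexity_eq (h : IsComplementPair t u Q M) (e : ℕ) :
    ((X : (ZMod 2)[X]) ^ gcdParam (2 * M) e - 1 ∣ X ^ (2 * (2 * M)) - 1) ∧
    (∀ f : (ZMod 2)[X], IsMinimalPolynomial (interleave ![t, leftShift e u]) f ↔
      f = (X ^ (2 * (2 * M)) - 1) / (X ^ gcdParam (2 * M) e - 1)) ∧
    (linearComplexity (interleave ![t, leftShift e u]) : ℤ) =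
      2 * ((2 * M : ℕ) : ℤ) - (gcdParam (2 * M) e : ℤ) := by
  obtain ⟨hnM, hGn, hG⟩ := gcdParam_dvd h.pos e
  have hP : 0 < 2 * (2 * M) := by have := h.pos; omega
  have hGP : gcdParam (2 * M) e ∣ 2 * (2 * M) :=
    (hGn.trans hnM).trans ⟨4, by ring⟩
  have hdvd : (X : (ZMod 2)[X]) ^ gcdParam (2 * M) e - 1 ∣ X ^ (2 * (2 * M)) - 1 :=
    dvd_pow_sub_one_of_dvd hGP
  obtain ⟨q, hq⟩ := hdvd
  obtain ⟨r, hr⟩ := h.X_pow_gcdParam_sub_one_dvd_periodPoly e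
  have hGm := X_pow_sub_one_monic (F := ZMod 2) hG.pos
  have hqm : q.Monic := hGm.of_mul_monic_left (hq ▸ X_pow_sub_one_monic hP)
  have hann := annihilator_of_periodic hP (h.periodic_interleave e) hr hq
    (h.isCoprime_cofactors e hq hr)
  refine ⟨⟨q, hq⟩, fun f => ?_, ?_⟩
  · rw [isMinimalPolynomial_iff_of_annihilator hqm hann, hq,
      mul_div_cancel_left₀ _ hGm.ne_zero]
  · have hdeg := congrArg natDegree hq
    rw [hGm.natDegree_mul hqm, X_pow_sub_one_natDegree, X_pow_sub_one_natDegree] at hdeg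
    rw [linearComplexity_of_annihilator hqm hann]
    push_cast
    omega

end IsComplementPair

theorem isComplementPair_geomSeq {p : ℕ} [Fact p.Prime] (hp : p ≠ 2) {K : Type*} [Field K]
    [Algebra (ZMod p) K] [Finite K] {ω : Kˣ} (hω : ∀ x : Kˣ, x ∈ Subgroup.zpowers ω) {M : ℕ}
    (hM : M * (p - 1) = Nat.card K - 1) :
    IsComplementPair (geomSeq₁ p ω) (geomSeq₂ p ω)
      (fun n => Algebra.trace (ZMod p) K ((ω : K) ^ n) ≠ 0) M where
  pos := by
    have : 1 < Nat.card K := Finite.one_lt_card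
    refine Nat.pos_of_ne_zero ?_
    rintro rfl
    omega
  left := geomSeq₁_add hp hω hM
  right := geomSeq₂_add hp hω hM
  periodic := periodic_trace_ne_zero hp hω hM
  odd_card := odd_card_trace_ne_zero hp hω hM
  even_card := even_card_trace_ne_zero_and hp hω hM

theorem mainTheorem1 (p m : ℕ) [Fact p.Prime] (hp : 2 < p) (hm : 1 < m)
    {K : Type*} [Field K] [Algebra (ZMod p) K] (hK : Nat.card K = p ^ m)
    (ω : Kˣ) (hω : ∀ x : Kˣ, x ∈ Subgroup.zpowers ω)
    (N : ℕ) (hN : N = geomPeriod p m) (e : ℕ) (he : e < N) :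
    ((X : (ZMod 2)[X]) ^ gcdParam N e - 1 ∣ X ^ (2 * N) - 1) ∧
    (∀ f : (ZMod 2)[X], IsMinimalPolynomial (interleavedGeomSeq p ω e) f ↔
      f = (X ^ (2 * N) - 1) / (X ^ gcdParam N e - 1)) ∧
    (linearComplexity (interleavedGeomSeq p ω e) : ℤ) = 2 * (N : ℤ) - (gcdParam N e : ℤ) := by
  have hfin : Finite K := Nat.finite_of_card_ne_zero (by rw [hK]; positivity)
  have hdvd : p - 1 ∣ p ^ m - 1 := by simpa using Nat.sub_dvd_pow_sub_pow p 1 m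
  obtain ⟨M, hM⟩ := hdvd
  have hNM : N = 2 * M := by
    rw [hN, geomPeriod, hM, mul_left_comm, Nat.mul_div_cancel_left _ (by omega)]
  subst hNM
  exact (isComplementPair_geomSeq hp.ne' hω (by rw [hK, hM, mul_comm]))
    |>.isMinimalPolynomial_iff_and_linearComplexity_eq e
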